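/- All Banach algebras are complex and need not have an identity. Let $\Omega$ be a locally compact Hausdorff space, and let $\mathcal U=\{\Omega,(A_t)_{t\in\Omega},\Theta\}$ be a continuous field of non-zero Banach algebras over $\Omega$: each $A_t$ is a non-zero Banach algebra and $\Theta$ is a subalgebra of $\prod_{t\in\Omega}A_t$ such that (i) $\{x(t):x\in\Theta\}$ is dense in $A_t$ for every $t$; (ii) $t\mapsto\|x(t)\|$ is continuous for every $x\in\Theta$; (iii) if $x\in\prod_t A_t$ and for every $t_0\in\Omega$ and $\varepsilon>0$ there is $x'\in\Theta$ with $\|x(t)-x'(t)\|\le\varepsilon$ for all $t$ in a neighbourhood of $t_0$, then $x\in\Theta$. For $Y\subseteq\Omega$ let $\mathcal U|_Y$ be the induced field over $Y$, whose continuous vector fields are the $x\in\prod_{t\in Y}A_t$ that near every point of $Y$ can be uniformly approximated by members of $\Theta$ in the same sense. A field over a space $X$ is trivial if, through a family of isometric algebra isomorphisms of the fibres, it is isomorphic to the field of all continuous functions from $X$ to some fixed Banach algebra. A field $\mathcal V$ over $X$ is $\sigma$-locally trivial if there are an open cover $\mathcal C$ of $X$ such that $\mathcal V|_U$ is trivial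 for each $U\in\mathcal C$, and a countable open cover $\{V_j\}$ of $X$ such that each closure $\overline{V_j}$ (in $X$) is contained in some member of $\mathcal C$. Suppose that $\Omega$ is the disjoint union of a family of open subsets $(W_\mu)_{\mu\in\mathcal M}$ such that each $\mathcal U|_{W_\mu}$ is $\sigma$-locally trivial. Let $\mathfrak A$ be the Banach algebra of all $x\in\Theta$ such that $\|x(t)\|$ vanishes at infinity on $\Omega$, with the norm $\|x\|=\sup_{t\in\Omega}\|x(t)\|$. Suppose that $\mathfrak A$ is left projective or right projective; that is, for $P=\mathfrak A$ as a left (respectively right) Banach $\mathfrak A$-module, every morphism $\varphi:Y\to P$ of left (right) Banach $\mathfrak A$-modules that has a bounded linear right inverse has a right inverse that is a morphism of left (right) Banach $\mathfrak A$-modules. Then $\Omega$ is paracompact. -/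

import Mathlib

open Filter Topology
open scoped ENNReal

universe u v w w'

section Modules

/-- A left Banach module structure on the complex Banach space `X` over the (not necessarily unital)
complex Banach algebra `A`: a bounded bilinear outer multiplication `act a x = a · x` with
`(a b) · x = a · (b · x)`. -/
structure LeftBanachModule (A : Type w) (X : Type w') [NonUnitalNormedRing A] [NormedSpace ℂ A]
    [NormedAddCommGroup X] [NormedSpace ℂ X] where
  act : A →L[ℂ] X →L[ℂ] X
  mul_act : ∀ (a b : A) (x : X), act (a * b) x = act a (act b x)

/-- A right Banach module structure: `act a x = x · a`, with `x · (a b) = (x · a) · b`. -/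
structure RightBanachModule (A : Type w) (X : Type w') [NonUnitalNormedRing A] [NormedSpace ℂ A]
    [NormedAddCommGroup X] [NormedSpace ℂ X] where
  act : A →L[ℂ] X →L[ℂ] X
  mul_act : ∀ (a b : A) (x : X), act (a * b) x = act b (act a x)

/-- The left Banach module `P` is projective: every morphism `φ : Y → P` of left Banach modules
that has a right inverse among the bounded linear operators (and so is an epimorphism) has a right
inverse among the morphisms of left Banach modules. -/
def LeftBanachModule.IsProjective {A : Type w} {P : Type w'} [NonUnitalNormedRing A]
    [NormedSpace ℂ A] [NormedAddCommGroup P] [NormedSpace ℂ P] (N : LeftBanachModule A P) : Prop :=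
  ∀ (Y : Type (max w w')) [NormedAddCommGroup Y] [NormedSpace ℂ Y] [CompleteSpace Y]
    (M : LeftBanachModule A Y) (φ : Y →L[ℂ] P),
    (∀ (a : A) (y : Y), φ (M.act a y) = N.act a (φ y)) →
    (∃ σ : P →L[ℂ] Y, ∀ x, φ (σ x) = x) →
    ∃ ψ : P →L[ℂ] Y, (∀ (a : A) (x : P), ψ (N.act a x) = M.act a (ψ x)) ∧ ∀ x, φ (ψ x) = x

/-- The right Banach module `P` is projective. -/
def RightBanachModule.IsProjective {A : Type w} {P : Type w'} [NonUnitalNormedRing A]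
    [NormedSpace ℂ A] [NormedAddCommGroup P] [NormedSpace ℂ P] (N : RightBanachModule A P) : Prop :=
  ∀ (Y : Type (max w w')) [NormedAddCommGroup Y] [NormedSpace ℂ Y] [CompleteSpace Y]
    (M : RightBanachModule A Y) (φ : Y →L[ℂ] P),
    (∀ (a : A) (y : Y), φ (M.act a y) = N.act a (φ y)) →
    (∃ σ : P →L[ℂ] Y, ∀ x, φ (σ x) = x) →
    ∃ ψ : P →L[ℂ] Y, (∀ (a : A) (x : P), ψ (N.act a x) = M.act a (ψ x)) ∧ ∀ x, φ (ψ x) = x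

variable (A : Type w) [NonUnitalNormedRing A] [NormedSpace ℂ A] [IsScalarTower ℂ A A]
  [SMulCommClass ℂ A A]

/-- `A` as a left module over itself. -/
noncomputable def LeftBanachModule.self : LeftBanachModule A A where
  act := ContinuousLinearMap.mul ℂ A
  mul_act a b x := mul_assoc a b x

/-- `A` as a right module over itself. -/
noncomputable def RightBanachModule.self : RightBanachModule A A where
  act := (ContinuousLinearMap.mul ℂ A).flip
  mul_act a b x := (mul_assoc x a b).symm

/-- A Banach algebra is left projective if it is projective as a left Banach module over itself. -/
def IsLeftProjective [CompleteSpace A] : Prop := (LeftBanachModule.self A).IsProjective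

/-- A Banach algebra is right projective if it is projective as a right Banach module over
itself. -/
def IsRightProjective [CompleteSpace A] : Prop := (RightBanachModule.self A).IsProjective

end Modules

section Fields

variable {Ω : Type u} [TopologicalSpace Ω] {A : Ω → Type v} [∀ t, NonUnitalNormedRing (A t)]
  [∀ t, NormedSpace ℂ (A t)]

/-- A continuous field of (complex, not necessarily unital) Banach algebras over `Ω` with fibres
`A t`: a subalgebra `Θ` of `∏ t, A t` with the three axioms below. The fibres are required to be
complete, and `Ω` to be locally compact Hausdorff, where the notion is used. -/
structure ContinuousField {Ω : Type u} [TopologicalSpace Ω] (A : Ω → Type v)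
    [∀ t, NonUnitalNormedRing (A t)] [∀ t, NormedSpace ℂ (A t)] where
  Θ : NonUnitalSubalgebra ℂ (∀ t, A t)
  dense : ∀ t, Dense {a : A t | ∃ x ∈ Θ, x t = a}
  continuous_norm : ∀ x ∈ Θ, Continuous fun t => ‖x t‖
  locally_closed : ∀ x : ∀ t, A t,
    (∀ t₀, ∀ ε > 0, ∃ x' ∈ Θ, ∀ᶠ t in 𝓝 t₀, ‖x t - x' t‖ ≤ ε) → x ∈ Θ

namespace ContinuousField

/-- The constant field over `Ω` defined by the Banach algebra `B`. -/
def const (Ω : Type u) [TopologicalSpace Ω] (B : Type v) [NonUnitalNormedRing B]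
    [NormedSpace ℂ B] [IsScalarTower ℂ B B] [SMulCommClass ℂ B B] :
    ContinuousField (fun _ : Ω => B) where
  Θ :=
    { carrier := {x | Continuous x}
      add_mem' := fun ha hb => Continuous.add ha hb
      zero_mem' := continuous_const
      mul_mem' := fun ha hb => Continuous.mul ha hb
      smul_mem' := fun c _ hx => Continuous.const_smul hx c }
  dense t := dense_univ.mono fun a _ => ⟨fun _ => a, continuous_const, rfl⟩
  continuous_norm x hx := Continuous.norm hx
  locally_closed x hx := by
    refine continuous_of_locally_uniform_approx_of_continuousAt fun t₀ V hV => ?_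
    obtain ⟨ε, hε, hV⟩ := Metric.mem_uniformity_dist.1 hV
    obtain ⟨x', hx', h⟩ := hx t₀ (ε / 2) (half_pos hε)
    refine ⟨_, h, x', Continuous.continuousAt hx', fun t ht => hV ?_⟩
    rw [dist_eq_norm]
    exact lt_of_le_of_lt ht (half_lt_self hε)

/-- The field induced on a subset `Y` of `Ω`: its continuous vector fields are the vector fields
over `Y` that, near every point of `Y`, are uniformly approximated by members of `Θ`. -/
def restrict (𝒰 : ContinuousField A) (Y : Set Ω) : ContinuousField (fun t : Y => A t) where
  Θ :=
    { carrier := {x | ∀ t₀ : Y, ∀ ε > 0, ∃ x' ∈ 𝒰.Θ, ∀ᶠ t : Y in 𝓝 t₀, ‖x t - x' t‖ ≤ ε}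
      zero_mem' := fun t₀ ε hε => ⟨0, zero_mem _, by simpa using hε.le⟩
      add_mem' := by
        intro x y hx hy t₀ ε hε
        obtain ⟨x', hx', h1⟩ := hx t₀ (ε / 2) (half_pos hε)
        obtain ⟨y', hy', h2⟩ := hy t₀ (ε / 2) (half_pos hε)
        refine ⟨x' + y', add_mem hx' hy', ?_⟩
        filter_upwards [h1, h2] with t h1 h2
        calc ‖(x + y) t - (x' + y') t‖ = ‖(x t - x' t) + (y t - y' t)‖ := by
              congr 1; simp only [Pi.add_apply]; abel
          _ ≤ ε := (norm_add_le _ _).trans (by linarith)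
      mul_mem' := by
        intro x y hx hy t₀ ε hε
        obtain ⟨x₁, hx₁, h1⟩ := hx t₀ 1 one_pos
        have hX := 𝒰.continuous_norm x₁ hx₁
        set C : ℝ := ‖x₁ t₀‖ + 2 with hC
        have hCpos : 0 < C := by positivity
        obtain ⟨y', hy', h2⟩ := hy t₀ (ε / (2 * C)) (by positivity)
        have hY := 𝒰.continuous_norm y' hy'
        set D : ℝ := ‖y' t₀‖ + 1 with hD
        have hDpos : 0 < D := by positivity
        obtain ⟨x', hx', h3⟩ := hx t₀ (ε / (2 * D)) (by positivity)
        refine ⟨x' * y', mul_mem hx' hy', ?_⟩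
        have e1 : ∀ᶠ t : Y in 𝓝 t₀, ‖x₁ t‖ < ‖x₁ t₀‖ + 1 :=
          (hX.comp continuous_subtype_val).continuousAt.eventually_lt continuousAt_const
            (by simp)
        have e2 : ∀ᶠ t : Y in 𝓝 t₀, ‖y' t‖ < D :=
          (hY.comp continuous_subtype_val).continuousAt.eventually_lt continuousAt_const
            (by simp [hD])
        filter_upwards [h1, h2, h3, e1, e2] with t h1 h2 h3 e1 e2
        have hxC : ‖x t‖ ≤ C := by
          have := norm_add_le (x t - x₁ t) (x₁ t)
          rw [sub_add_cancel] at this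
          linarith
        calc ‖(x * y) t - (x' * y') t‖ = ‖x t * (y t - y' t) + (x t - x' t) * y' t‖ := by
              congr 1; simp only [Pi.mul_apply, mul_sub, sub_mul]; abel
          _ ≤ ‖x t‖ * ‖y t - y' t‖ + ‖x t - x' t‖ * ‖y' t‖ :=
              (norm_add_le _ _).trans (add_le_add (norm_mul_le _ _) (norm_mul_le _ _))
          _ ≤ C * (ε / (2 * C)) + (ε / (2 * D)) * D := by gcongr
          _ = ε := by field_simp; ring
      smul_mem' := by
        intro c x hx t₀ ε hε
        obtain ⟨x', hx', h⟩ := hx t₀ (ε / (‖c‖ + 1)) (by positivity)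
        refine ⟨c • x', SMulMemClass.smul_mem c hx', ?_⟩
        filter_upwards [h] with t h
        calc ‖(c • x) t - (c • x') t‖ = ‖c • (x t - x' t)‖ := by
              simp only [Pi.smul_apply, smul_sub]
          _ ≤ (‖c‖ + 1) * (ε / (‖c‖ + 1)) := by
              rw [norm_smul]; gcongr; linarith
          _ = ε := by field_simp }
  dense t := by
    refine (𝒰.dense t).mono ?_
    rintro a ⟨x, hx, rfl⟩
    exact ⟨fun s => x s, fun t₀ ε hε => ⟨x, hx, by simpa using hε.le⟩, rfl⟩
  continuous_norm x hx := by
    refine continuous_of_locally_uniform_approx_of_continuousAt fun t₀ V hV => ?_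
    obtain ⟨ε, hε, hV⟩ := Metric.mem_uniformity_dist.1 hV
    obtain ⟨x', hx', h⟩ := hx t₀ (ε / 2) (half_pos hε)
    refine ⟨_, h, fun t => ‖x' t‖,
      ((𝒰.continuous_norm x' hx').comp continuous_subtype_val).continuousAt, fun t ht => hV ?_⟩
    rw [Real.dist_eq]
    exact lt_of_le_of_lt ((abs_norm_sub_norm_le _ _).trans ht) (half_lt_self hε)
  locally_closed x hx := by
    intro t₀ ε hε
    obtain ⟨y, hy, h1⟩ := hx t₀ (ε / 2) (half_pos hε)
    obtain ⟨x', hx', h2⟩ := hy t₀ (ε / 2) (half_pos hε)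
    refine ⟨x', hx', ?_⟩
    filter_upwards [h1, h2] with t h1 h2
    have := norm_sub_le_norm_sub_add_norm_sub (x t) (y t) (x' t)
    linarith

/-- An isomorphism of continuous fields of Banach algebras over `Ω`: a family of isometric algebra
isomorphisms of the fibres that transforms `Θ` into `Θ'`. -/
structure Iso {A' : Ω → Type v} [∀ t, NonUnitalNormedRing (A' t)] [∀ t, NormedSpace ℂ (A' t)]
    (𝒰 : ContinuousField A) (𝒰' : ContinuousField A') where
  toFun : ∀ t, A t ≃ₗᵢ[ℂ] A' t
  map_mul : ∀ t (a b : A t), toFun t (a * b) = toFun t a * toFun t b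
  map_Θ : ∀ x : ∀ t, A t, x ∈ 𝒰.Θ ↔ (fun t => toFun t (x t)) ∈ 𝒰'.Θ

/-- A field is trivial if it is isomorphic to the constant field defined by a Banach algebra. -/
def IsTrivial (𝒰 : ContinuousField A) : Prop :=
  ∃ (B : Type v) (_ : NonUnitalNormedRing B) (_ : NormedSpace ℂ B) (_ : IsScalarTower ℂ B B)
    (_ : SMulCommClass ℂ B B) (_ : CompleteSpace B), Nonempty (𝒰.Iso (const Ω B))

/-- `𝒰` is σ-locally trivial: there are an open cover `𝓒` of `Ω` such that `𝒰` is trivial on each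
member of `𝓒`, and a countable open cover `𝓥` of `Ω` such that the closure of each member
of `𝓥` lies in a member of `𝓒`. -/
def IsSigmaLocallyTrivial (𝒰 : ContinuousField A) : Prop :=
  ∃ 𝓒 : Set (Set Ω), (∀ U ∈ 𝓒, IsOpen U ∧ (𝒰.restrict U).IsTrivial) ∧ ⋃₀ 𝓒 = Set.univ ∧
    ∃ 𝓥 : Set (Set Ω), 𝓥.Countable ∧ (∀ V ∈ 𝓥, IsOpen V ∧ ∃ U ∈ 𝓒, closure V ⊆ U) ∧
      ⋃₀ 𝓥 = Set.univ

/-- The Banach algebra defined by `𝒰`: the members `x` of `Θ` for which `‖x t‖` vanishes at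
infinity, with the supremum norm (inherited from the bounded vector fields `lp A ∞`). -/
def sectionAlgebra (𝒰 : ContinuousField A) : NonUnitalSubalgebra ℂ (lp A ∞) where
  carrier := {x | (x : ∀ t, A t) ∈ 𝒰.Θ ∧ Tendsto (fun t => ‖x t‖) (cocompact Ω) (𝓝 0)}
  zero_mem' := ⟨zero_mem _, by simpa using tendsto_const_nhds⟩
  add_mem' := by
    rintro x y ⟨hx, hx'⟩ ⟨hy, hy'⟩
    refine ⟨add_mem hx hy, ?_⟩
    exact squeeze_zero (fun _ => norm_nonneg _) (fun t => norm_add_le (x t) (y t))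
      (by simpa using hx'.add hy')
  mul_mem' := by
    rintro x y ⟨hx, hx'⟩ ⟨hy, hy'⟩
    refine ⟨mul_mem hx hy, ?_⟩
    exact squeeze_zero (fun _ => norm_nonneg _) (fun t => norm_mul_le (x t) (y t))
      (by simpa using hx'.mul hy')
  smul_mem' := by
    rintro c x ⟨hx, hx'⟩
    refine ⟨SMulMemClass.smul_mem c hx, ?_⟩
    exact squeeze_zero (fun _ => norm_nonneg _) (fun t => (norm_smul c (x t)).le)
      (by simpa using hx'.const_mul ‖c‖)

/-- Boundedness is automatic: a member of `Θ` whose norm vanishes at infinity is bounded, so it is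
an element of the section algebra. -/
theorem memℓp_of_vanishing (𝒰 : ContinuousField A) {x : ∀ t, A t} (hx : x ∈ 𝒰.Θ)
    (h : Tendsto (fun t => ‖x t‖) (cocompact Ω) (𝓝 0)) : Memℓp x ∞ := by
  refine memℓp_infty ?_
  obtain ⟨K, hK, hKx⟩ := mem_cocompact.1 (h.eventually (gt_mem_nhds one_pos))
  obtain ⟨C, hC⟩ := hK.bddAbove_image (𝒰.continuous_norm x hx).continuousOn
  refine ⟨max C 1, ?_⟩
  rintro _ ⟨t, rfl⟩
  by_cases ht : t ∈ K
  · exact le_max_of_le_left (hC ⟨t, ht, rfl⟩)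
  · exact le_max_of_le_right (le_of_lt (hKx ht))

noncomputable instance (𝒰 : ContinuousField A) : NormedSpace ℂ 𝒰.sectionAlgebra where
  norm_smul_le c x := norm_smul_le c (x : lp A ∞)

instance [∀ t, CompleteSpace (A t)] (𝒰 : ContinuousField A) : CompleteSpace 𝒰.sectionAlgebra := by
  have hcl : IsClosed (𝒰.sectionAlgebra : Set (lp A ∞)) := by
    refine isClosed_of_closure_subset fun x hx => ?_
    have key : ∀ ε > 0, ∃ y ∈ 𝒰.sectionAlgebra, ∀ t, ‖x t - y t‖ ≤ ε := by
      intro ε hε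
      obtain ⟨y, hy, hxy⟩ := Metric.mem_closure_iff.1 hx ε hε
      refine ⟨y, hy, fun t => ?_⟩
      rw [dist_eq_norm] at hxy
      exact (lp.norm_apply_le_norm ENNReal.top_ne_zero (x - y) t).trans hxy.le
    constructor
    · refine 𝒰.locally_closed _ fun t₀ ε hε => ?_
      obtain ⟨y, hy, h⟩ := key ε hε
      exact ⟨y, hy.1, Eventually.of_forall h⟩
    · rw [Metric.tendsto_nhds]
      intro ε hε
      obtain ⟨y, hy, h⟩ := key (ε / 2) (half_pos hε)
      filter_upwards [(Metric.tendsto_nhds.1 hy.2) (ε / 2) (half_pos hε)] with t ht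
      simp only [dist_zero_right, norm_norm] at ht ⊢
      have := norm_add_le (x t - y t) (y t)
      rw [sub_add_cancel] at this
      linarith [h t]
  exact hcl.completeSpace_coe

end ContinuousField

end Fields

open scoped ZeroAtInfty BoundedContinuousFunction

/-! Projectivity is converted into a relation on `Ω` that is a neighbourhood of the diagonal and
spreads compact sets only over σ-compact ones.

Take the left case (the right case is the same with the product flipped). Let `Z` be a closed piece
of `Ω` over which the field is trivial with fibre `B`. Pair each section with a kernel `F(s,t)` on
`Z × Z`, continuous and bounded from `s ∈ Z` to `C₀(Z, B)`, whose diagonal is that section. These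
pairs form a module over the section algebra, acting through `s`, and the projection to sections has
a bounded linear right inverse, given by kernels independent of `s`. Projectivity replaces it by a
module morphism, so there are kernels `ρ(a)` with `ρ(ab)(s,t) = a(s) ρ(b)(s,t)` and `ρ(a)(t,t) =
a(t)` (`BilinearProjective.exists_kernel`).

Pick `x`, `y` in `B` with `xy ≠ 0`; they exist because projectivity also rules out a zero product on
`B`. For a cutoff `f` with `f(s) = 1`, the value `Ψ(s) = x ρ(f y)(s, ·)` does not depend on `f`. So
`Ψ : Z → C₀(Z, B)` is continuous even when `Z` is not compact, and `Ψ(s)(s) = xy`. The relation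
`‖Ψ(s)(t)‖ > ‖xy‖/2`, symmetrized, contains a neighbourhood of each diagonal point in its slice, and
it sends compact sets into compact sets.

A compact set meets finitely many `W μ`, and each of these uses countably many pieces, so the union
of the relations sends compact sets into σ-compact ones. The classes of its transitive closure are
clopen and σ-compact, hence paracompact, and so is their disjoint union `Ω`
(`paracompactSpace_of_relation`). -/

/-! ### Paracompactness from a relation -/

/-- Covers are refined class by class. The union of the refinements stays locally finite because
every point has its own open class as a neighbourhood, which misses the sets coming from all other
classes. -/
theorem paracompactSpace_of_clopen_partition {X : Type u} [TopologicalSpace X] (s : Setoid X)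
    (hopen : ∀ x, IsOpen {y | s x y}) (hpar : ∀ x, ParacompactSpace {y | s x y}) :
    ParacompactSpace X := by
  refine ⟨fun α c hc hcov => ?_⟩
  let cls : Quotient s → Set X := fun q => {y | s q.out y}
  have key : ∀ q : Quotient s, ∃ t : α → Set (cls q), (∀ a, IsOpen (t a)) ∧
      ⋃ a, t a = Set.univ ∧ LocallyFinite t ∧ ∀ a, t a ⊆ Subtype.val ⁻¹' (c a) := by
    intro q
    have := hpar q.out
    refine precise_refinement (fun a => Subtype.val ⁻¹' c a)
      (fun a => (hc a).preimage continuous_subtype_val) ?_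
    rw [← Set.preimage_iUnion, hcov, Set.preimage_univ]
  choose t hto htc htf hts using key
  have hmem : ∀ x : X, x ∈ cls (Quotient.mk s x) := fun x => Quotient.exact (Quotient.out_eq _)
  have huniq : ∀ (q : Quotient s) (x : X), x ∈ cls q → q = Quotient.mk s x := by
    intro q x hx
    rw [← Quotient.out_eq q]
    exact Quotient.sound hx
  refine ⟨Quotient s × α, fun p => Subtype.val '' t p.1 p.2, fun p =>
    (hopen p.1.out).isOpenMap_subtype_val _ (hto _ _), ?_, ?_, fun p => ⟨p.2, ?_⟩⟩
  · refine Set.eq_univ_of_forall fun x => ?_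
    have hx : (⟨x, hmem x⟩ : cls (Quotient.mk s x)) ∈ ⋃ a, t (Quotient.mk s x) a := by
      rw [htc]; trivial
    obtain ⟨a, ha⟩ := Set.mem_iUnion.1 hx
    exact Set.mem_iUnion.2 ⟨(Quotient.mk s x, a), _, ha, rfl⟩
  · intro x
    obtain ⟨N, hN, hfin⟩ := htf (Quotient.mk s x) ⟨x, hmem x⟩
    refine ⟨Subtype.val '' N, (hopen _).isOpenMap_subtype_val.image_mem_nhds hN,
      (hfin.image fun a => (Quotient.mk s x, a)).subset ?_⟩
    rintro ⟨q, a⟩ ⟨z, ⟨z₁, hz₁, rfl⟩, ⟨z₂, hz₂, hz⟩⟩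
    have hq : q = Quotient.mk s x := by
      exact (huniq q z₁ z₁.2).trans ((congrArg _ hz.symm).trans (huniq _ z₂ z₂.2).symm)
    subst hq
    obtain rfl := Subtype.ext hz
    exact ⟨a, ⟨z₂, hz₁, hz₂⟩, rfl⟩
  · rintro _ ⟨z, hz, rfl⟩
    exact hts _ _ hz

/-- The classes of the reflexive transitive closure of `R` are open, hence clopen. A class is
exhausted by countably many steps from one point, each step keeping σ-compactness, so it is
σ-compact and locally compact. -/
theorem paracompactSpace_of_relation {X : Type u} [TopologicalSpace X] [T2Space X]
    [LocallyCompactSpace X] (R : X → X → Prop) (hsymm : ∀ x y, R x y → R y x)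
    (hnhds : ∀ x, ∀ᶠ y in 𝓝 x, R x y)
    (hcpt : ∀ K : Set X, IsCompact K → ∃ S : Set X, IsSigmaCompact S ∧ ∀ x ∈ K, ∀ y, R x y → y ∈ S) :
    ParacompactSpace X := by
  let s : Setoid X := ⟨Relation.ReflTransGen R, fun _ => .refl,
    fun h => @Std.Symm.symm _ _ (@Relation.ReflTransGen.stdSymm _ _ ⟨hsymm⟩) _ _ h, fun h h' => h.trans h'⟩
  have hopen : ∀ x, IsOpen {y | s x y} := by
    intro x
    refine isOpen_iff_mem_nhds.2 fun y hy => ?_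
    filter_upwards [hnhds y] with z hz
    exact Relation.ReflTransGen.tail hy hz
  have hclosed : ∀ x, IsClosed {y | s x y} := by
    intro x
    refine isOpen_compl_iff.1 (isOpen_iff_mem_nhds.2 fun y hy => ?_)
    filter_upwards [(hopen y).mem_nhds (s.refl y)] with z hz hxz
    exact hy (s.trans hxz (s.symm hz))
  have hsig : ∀ T : Set X, IsSigmaCompact T →
      ∃ S : Set X, IsSigmaCompact S ∧ ∀ x ∈ T, ∀ y, R x y → y ∈ S := by
    rintro T ⟨K, hK, rfl⟩
    choose S hS h using fun n => hcpt (K n) (hK n)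
    refine ⟨⋃ n, S n, isSigmaCompact_iUnion _ hS, fun x hx y hxy => ?_⟩
    obtain ⟨n, hn⟩ := Set.mem_iUnion.1 hx
    exact Set.mem_iUnion.2 ⟨n, h n x hn y hxy⟩
  refine paracompactSpace_of_clopen_partition s hopen fun x => ?_
  choose! next hnext hstep using hsig
  have hT : ∀ n, IsSigmaCompact (next^[n] {x}) := by
    intro n
    induction n with
    | zero => exact isCompact_singleton.isSigmaCompact
    | succ n ih => rw [Function.iterate_succ_apply']; exact hnext _ ih
  have hsub : {y | s x y} ⊆ ⋃ n, next^[n] {x} := by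
    intro y hy
    change Relation.ReflTransGen R x y at hy
    induction hy with
    | refl => exact Set.mem_iUnion.2 ⟨0, rfl⟩
    | tail _ h ih =>
      obtain ⟨n, hn⟩ := Set.mem_iUnion.1 ih
      refine Set.mem_iUnion.2 ⟨n + 1, ?_⟩
      rw [Function.iterate_succ_apply']
      exact hstep _ (hT n) _ hn _ h
  have hC : IsSigmaCompact {y | s x y} :=
    (isSigmaCompact_iUnion _ hT).of_isClosed_subset (hclosed x) hsub
  have : SigmaCompactSpace {y | s x y} := isSigmaCompact_iff_sigmaCompactSpace.1 hC
  have : LocallyCompactSpace {y | s x y} := (hopen x).locallyCompactSpace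
  infer_instance

/-! ### Left and right projectivity in one form -/

/-- Projectivity of `E` as a module over itself with the bilinear multiplication `m`. With `m` the
multiplication of a Banach algebra or its flip, this covers left and right projectivity. -/
def BilinearProjective {E : Type w} [NormedAddCommGroup E] [NormedSpace ℂ E]
    (m : E →L[ℂ] E →L[ℂ] E) : Prop :=
  ∀ (Y : Type w) [NormedAddCommGroup Y] [NormedSpace ℂ Y] [CompleteSpace Y]
    (act : E →L[ℂ] Y →L[ℂ] Y) (φ : Y →L[ℂ] E),
    (∀ a b y, act (m a b) y = act a (act b y)) → (∀ a y, φ (act a y) = m a (φ y)) →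
    (∃ σ : E →L[ℂ] Y, ∀ x, φ (σ x) = x) →
    ∃ ψ : E →L[ℂ] Y, (∀ a x, ψ (m a x) = act a (ψ x)) ∧ ∀ x, φ (ψ x) = x

section
variable (A : Type w) [NonUnitalNormedRing A] [NormedSpace ℂ A] [IsScalarTower ℂ A A]
  [SMulCommClass ℂ A A] [CompleteSpace A]

theorem IsLeftProjective.bilinearProjective (h : IsLeftProjective A) :
    BilinearProjective (ContinuousLinearMap.mul ℂ A) :=
  fun Y _ _ _ act φ hact hφ hσ => h Y ⟨act, hact⟩ φ hφ hσ

theorem IsRightProjective.bilinearProjective (h : IsRightProjective A) :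
    BilinearProjective (ContinuousLinearMap.mul ℂ A).flip :=
  fun Y _ _ _ act φ hact hφ hσ => h Y ⟨act, fun a b x => hact b a x⟩ φ hφ hσ
end

/-! ### Function spaces on `Z` and `Z × Z` -/

section
variable (Z : Type u) [TopologicalSpace Z] (B : Type v) [NormedAddCommGroup B] [NormedSpace ℂ B]

/-- The Banach space of continuous functions from `Z` to `B` that vanish at infinity. -/
def Vanishing : Type (max u v) := C₀(Z, B)

noncomputable instance : NormedAddCommGroup (Vanishing Z B) :=
  inferInstanceAs (NormedAddCommGroup C₀(Z, B))

noncomputable instance : NormedSpace ℂ (Vanishing Z B) :=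
  inferInstanceAs (NormedSpace ℂ C₀(Z, B))

/-- The Banach space of bounded continuous functions from `Z` to `Vanishing Z B`, regarded as
functions of two variables. -/
def KernelSpace : Type (max u v) := Z →ᵇ Vanishing Z B

noncomputable instance : NormedAddCommGroup (KernelSpace Z B) :=
  inferInstanceAs (NormedAddCommGroup (Z →ᵇ Vanishing Z B))

noncomputable instance : NormedSpace ℂ (KernelSpace Z B) :=
  inferInstanceAs (NormedSpace ℂ (Z →ᵇ Vanishing Z B))

instance [CompleteSpace B] : CompleteSpace (Vanishing Z B) :=
  inferInstanceAs (CompleteSpace C₀(Z, B))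

instance [CompleteSpace B] : CompleteSpace (KernelSpace Z B) :=
  inferInstanceAs (CompleteSpace (Z →ᵇ Vanishing Z B))
end

section
variable {Z : Type u} [TopologicalSpace Z] {B : Type v} [NormedAddCommGroup B] [NormedSpace ℂ B]

namespace Vanishing

theorem norm_le {f : C₀(Z, B)} {C : ℝ} (hC : 0 ≤ C) (h : ∀ t, ‖f t‖ ≤ C) :
    ‖(show Vanishing Z B from f)‖ ≤ C :=
  (BoundedContinuousFunction.norm_le (f := f.toBCF) hC).2 h

/-- Evaluation at a point. -/
noncomputable def eval (t : Z) : Vanishing Z B →L[ℂ] B :=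
  LinearMap.mkContinuous ⟨⟨fun f : C₀(Z, B) => f t, fun _ _ => rfl⟩, fun _ _ => rfl⟩ 1
    fun f => by
      rw [one_mul]
      exact BoundedContinuousFunction.norm_coe_le_norm (ZeroAtInftyContinuousMap.toBCF f) t

theorem norm_eval_le (f : Vanishing Z B) (t : Z) : ‖eval t f‖ ≤ ‖f‖ :=
  BoundedContinuousFunction.norm_coe_le_norm (ZeroAtInftyContinuousMap.toBCF f) t

theorem ext {f g : Vanishing Z B} (h : ∀ t, eval t f = eval t g) : f = g :=
  ZeroAtInftyContinuousMap.ext (f := f) (g := g) h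

theorem continuous_eval (f : Vanishing Z B) : Continuous fun t => eval t f :=
  (show C₀(Z, B) from f).continuous

theorem tendsto_eval (f : Vanishing Z B) : Tendsto (fun t => eval t f) (cocompact Z) (𝓝 0) :=
  (show C₀(Z, B) from f).zero_at_infty'

/-- The pointwise action on `Vanishing Z B` induced by a bilinear map on `B`. -/
noncomputable def act (mB : B →L[ℂ] B →L[ℂ] B) : B →L[ℂ] Vanishing Z B →L[ℂ] Vanishing Z B :=
  LinearMap.mkContinuous₂
    (LinearMap.mk₂ ℂ (fun b f => (show Vanishing Z B from
        (⟨⟨fun t => mB b (eval t f), (mB b).continuous.comp f.continuous_eval⟩, by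
          have h := ((mB b).continuous.tendsto 0).comp f.tendsto_eval
          rw [map_zero] at h
          exact h⟩ : C₀(Z, B))))
      (fun b b' f => ext fun t => congrArg (· (eval t f)) (map_add mB b b'))
      (fun c b f => ext fun t => congrArg (· (eval t f)) (map_smul mB c b))
      (fun b f g => ext fun t => map_add (mB b) (eval t f) (eval t g))
      (fun c b f => ext fun t => map_smul (mB b) c (eval t f))) ‖mB‖
    fun b f => norm_le (by positivity) fun t =>
      (mB.le_opNorm₂ b (eval t f)).trans (by gcongr; exact f.norm_eval_le t)

@[simp] theorem eval_act (mB : B →L[ℂ] B →L[ℂ] B) (b : B) (f : Vanishing Z B) (t : Z) :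
    eval t (act mB b f) = mB b (eval t f) := rfl

end Vanishing

namespace KernelSpace

/-- Evaluation in the first variable. -/
noncomputable def eval (s : Z) : KernelSpace Z B →L[ℂ] Vanishing Z B :=
  BoundedContinuousFunction.evalCLM ℂ s

theorem norm_le {F : Z →ᵇ Vanishing Z B} {C : ℝ} (hC : 0 ≤ C) (h : ∀ t, ‖F t‖ ≤ C) :
    ‖(show KernelSpace Z B from F)‖ ≤ C :=
  (BoundedContinuousFunction.norm_le (f := F) hC).2 h

theorem norm_eval_le (F : KernelSpace Z B) (t : Z) : ‖eval t F‖ ≤ ‖F‖ :=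
  BoundedContinuousFunction.norm_coe_le_norm (α := Z) F t

theorem ext {F G : KernelSpace Z B} (h : ∀ t, eval t F = eval t G) : F = G :=
  BoundedContinuousFunction.ext (f := F) (g := G) h

theorem continuous_eval (F : KernelSpace Z B) : Continuous fun t => eval t F :=
  (show Z →ᵇ Vanishing Z B from F).continuous

variable {E : Type w} [NormedAddCommGroup E] [NormedSpace ℂ E]

/-- Multiplication of kernels by elements of `E` in the first variable. -/
noncomputable def act (mB : B →L[ℂ] B →L[ℂ] B) (r : E →L[ℂ] Vanishing Z B) :
    E →L[ℂ] KernelSpace Z B →L[ℂ] KernelSpace Z B :=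
  LinearMap.mkContinuous₂
    (LinearMap.mk₂ ℂ (fun a F => (show KernelSpace Z B from
        BoundedContinuousFunction.ofNormedAddCommGroup
        (fun s => Vanishing.act mB (Vanishing.eval s (r a)) (eval s F))
        (((Vanishing.act mB).continuous.comp (r a).continuous_eval).clm_apply F.continuous_eval)
        (‖Vanishing.act (Z := Z) mB‖ * ‖r a‖ * ‖F‖) fun s =>
          (ContinuousLinearMap.le_opNorm₂ _ _ _).trans (by
            gcongr
            · exact (r a).norm_eval_le s
            · exact F.norm_eval_le s)))
      (fun a b F => ext fun s => by
        change Vanishing.act mB (Vanishing.eval s (r (a + b))) (eval s F) =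
          Vanishing.act mB (Vanishing.eval s (r a)) (eval s F) +
            Vanishing.act mB (Vanishing.eval s (r b)) (eval s F)
        simp)
      (fun c a F => ext fun s => by
        change Vanishing.act mB (Vanishing.eval s (r (c • a))) (eval s F) =
          c • Vanishing.act mB (Vanishing.eval s (r a)) (eval s F)
        simp)
      (fun a F G => ext fun s =>
        map_add (Vanishing.act mB (Vanishing.eval s (r a))) (eval s F) (eval s G))
      (fun c a F => ext fun s =>
        map_smul (Vanishing.act mB (Vanishing.eval s (r a))) c (eval s F)))
    (‖Vanishing.act (Z := Z) mB‖ * ‖r‖)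
    fun a F => norm_le (by positivity) fun s =>
      ((Vanishing.act mB).le_opNorm₂ (Vanishing.eval s (r a)) (eval s F)).trans (by
        rw [mul_assoc _ ‖r‖]
        gcongr
        · exact ((r a).norm_eval_le s).trans (r.le_opNorm a)
        · exact F.norm_eval_le s)

@[simp] theorem eval_act (mB : B →L[ℂ] B →L[ℂ] B) (r : E →L[ℂ] Vanishing Z B) (a : E)
    (F : KernelSpace Z B) (s : Z) :
    eval s (act mB r a F) = Vanishing.act mB (Vanishing.eval s (r a)) (eval s F) := rfl

/-- The functions of two variables that do not depend on the first one. -/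
noncomputable def const : Vanishing Z B →L[ℂ] KernelSpace Z B :=
  LinearMap.mkContinuous ⟨⟨fun f => (show KernelSpace Z B from
    BoundedContinuousFunction.const Z f), fun _ _ => rfl⟩, fun _ _ => rfl⟩ 1 fun f =>
      norm_le (by positivity) fun _ => (one_mul ‖f‖).ge

@[simp] theorem eval_const (f : Vanishing Z B) (s : Z) : eval s (const f) = f := rfl

end KernelSpace

/-! ### The splitting kernel -/

variable {E : Type (max u v)} [NormedAddCommGroup E] [NormedSpace ℂ E]

/-- Pairs of an element of `E` and a kernel whose diagonal is the image of this element. -/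
noncomputable def diagonalModule (r : E →L[ℂ] Vanishing Z B) : Submodule ℂ (E × KernelSpace Z B) :=
  ⨅ t, LinearMap.ker ((((Vanishing.eval t).comp (KernelSpace.eval t)).comp
    (ContinuousLinearMap.snd ℂ E (KernelSpace Z B)) -
      ((Vanishing.eval t).comp r).comp
        (ContinuousLinearMap.fst ℂ E (KernelSpace Z B))).toLinearMap)

theorem mem_diagonalModule {r : E →L[ℂ] Vanishing Z B} {p : E × KernelSpace Z B} :
    p ∈ diagonalModule r ↔
      ∀ t, Vanishing.eval t (KernelSpace.eval t p.2) = Vanishing.eval t (r p.1) := by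
  simp [diagonalModule, sub_eq_zero]

theorem isClosed_diagonalModule (r : E →L[ℂ] Vanishing Z B) :
    IsClosed (diagonalModule r : Set (E × KernelSpace Z B)) := by
  rw [diagonalModule, Submodule.coe_iInf]
  exact isClosed_iInter fun t => ContinuousLinearMap.isClosed_ker _

/-- A projective Banach algebra represented by `r` in `C₀(Z, B)` has a splitting kernel. -/
theorem BilinearProjective.exists_kernel [CompleteSpace E] [CompleteSpace B]
    {m : E →L[ℂ] E →L[ℂ] E} (hm : BilinearProjective m)
    (hassoc : ∀ a b c, m (m a b) c = m a (m b c)) (mB : B →L[ℂ] B →L[ℂ] B)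
    (hassocB : ∀ a b c, mB (mB a b) c = mB a (mB b c)) (r : E →L[ℂ] Vanishing Z B)
    (hr : ∀ a b t, Vanishing.eval t (r (m a b)) =
      mB (Vanishing.eval t (r a)) (Vanishing.eval t (r b))) :
    ∃ ρ : E → KernelSpace Z B,
      (∀ a b s t, Vanishing.eval t (KernelSpace.eval s (ρ (m a b))) =
        mB (Vanishing.eval s (r a)) (Vanishing.eval t (KernelSpace.eval s (ρ b)))) ∧
      ∀ a t, Vanishing.eval t (KernelSpace.eval t (ρ a)) = Vanishing.eval t (r a) := by
  have : CompleteSpace (diagonalModule r) := (isClosed_diagonalModule r).completeSpace_coe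
  -- Acting through the first variable preserves the diagonal condition because `r` is
  -- multiplicative.
  let act : E →L[ℂ] diagonalModule r →L[ℂ] diagonalModule r :=
    LinearMap.mkContinuous₂
      (LinearMap.mk₂ ℂ (fun a p => (⟨(m a p.1.1, KernelSpace.act mB r a p.1.2),
          mem_diagonalModule.2 fun t => by simp [hr, mem_diagonalModule.1 p.2 t]⟩ :
            diagonalModule r))
        (fun _ _ _ => Subtype.ext (Prod.ext (by simp) (by simp)))
        (fun _ _ _ => Subtype.ext (Prod.ext (by simp) (by simp)))
        (fun _ _ _ => Subtype.ext (Prod.ext (by simp) (by simp)))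
        (fun _ _ _ => Subtype.ext (Prod.ext (by simp) (by simp))))
      (max ‖m‖ ‖KernelSpace.act mB r‖) fun a p => by
        refine max_le ?_ ?_
        · refine (m.le_opNorm₂ a p.1.1).trans ?_
          gcongr
          · exact le_max_left _ _
          · exact norm_fst_le p.1
        · refine ((KernelSpace.act mB r).le_opNorm₂ a p.1.2).trans ?_
          gcongr
          · exact le_max_right _ _
          · exact norm_snd_le p.1
  let φ : diagonalModule r →L[ℂ] E :=
    (ContinuousLinearMap.fst ℂ _ _).comp (diagonalModule r).subtypeL
  -- The bounded linear right inverse: the kernel `(s,t) ↦ r(a)(t)`, which need not respect the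
  -- action.
  let σ : E →L[ℂ] diagonalModule r :=
    ((ContinuousLinearMap.id ℂ E).prod (KernelSpace.const.comp r)).codRestrict
      (diagonalModule r) fun a => mem_diagonalModule.2 fun t => rfl
  obtain ⟨ψ, hψ, hφ⟩ := hm (diagonalModule r) act φ
    (fun a b y => Subtype.ext (Prod.ext (hassoc _ _ _)
      (KernelSpace.ext fun s => Vanishing.ext fun t => by
        change mB (Vanishing.eval s (r (m a b))) _ =
          mB (Vanishing.eval s (r a)) (mB (Vanishing.eval s (r b)) _)
        rw [hr, hassocB])))
    (fun a y => rfl) ⟨σ, fun x => rfl⟩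
  refine ⟨fun a => (ψ a).1.2, fun a b s t => ?_, fun a t => ?_⟩
  · change Vanishing.eval t (KernelSpace.eval s (ψ (m a b)).1.2) = _
    rw [hψ]
    rfl
  · change Vanishing.eval t (KernelSpace.eval t (ψ a).1.2) = _
    rw [mem_diagonalModule.1 (ψ a).2 t]
    exact congrArg (fun x => Vanishing.eval t (r x)) (hφ a)

end

/-! ### Non-vanishing of the product -/

section
variable {E : Type w} [NormedAddCommGroup E] [NormedSpace ℂ E]

/-- In a projective Banach algebra, a bounded functional that vanishes on all products vanishes on
the elements of square zero. -/
theorem BilinearProjective.eq_zero_of_vanishing [CompleteSpace E]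
    {m : E →L[ℂ] E →L[ℂ] E} (hm : BilinearProjective m)
    (hassoc : ∀ a b c, m (m a b) c = m a (m b c)) (χ : E →L[ℂ] ℂ) (hχ : ∀ a b, χ (m a b) = 0)
    {a : E} (ha : m a a = 0) : χ a = 0 := by
  -- The action `a · (b, z) = (ab, χ(a) χ(b))` is associative since `χ` kills products. A morphism
  -- splitting the first projection then gives `0 = ψ(aa) = a · ψ(a)`, whose second coordinate is
  -- `χ(a)²`.
  let act : E →L[ℂ] (E × ℂ) →L[ℂ] (E × ℂ) :=
    LinearMap.mkContinuous₂
      (LinearMap.mk₂ ℂ (fun a p => ((m a p.1, χ a * χ p.1) : E × ℂ))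
        (fun _ _ _ => by ext <;> simp [add_mul]) (fun _ _ _ => by ext <;> simp [mul_assoc])
        (fun _ _ _ => by ext <;> simp [mul_add])
        (fun _ _ _ => by ext <;> simp [mul_left_comm]))
      (max ‖m‖ (‖χ‖ * ‖χ‖)) fun a p => by
        refine max_le ?_ ?_
        · refine (m.le_opNorm₂ a p.1).trans ?_
          gcongr
          · exact le_max_left _ _
          · exact norm_fst_le p
        · calc ‖χ a * χ p.1‖ ≤ (‖χ‖ * ‖a‖) * (‖χ‖ * ‖p.1‖) := by
                rw [norm_mul]
                gcongr
                · exact χ.le_opNorm a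
                · exact χ.le_opNorm p.1
            _ = (‖χ‖ * ‖χ‖) * ‖a‖ * ‖p.1‖ := by ring
            _ ≤ _ := by
                gcongr
                · exact le_max_right _ _
                · exact norm_fst_le p
  obtain ⟨ψ, hψ, hφ⟩ := hm (E × ℂ) act (ContinuousLinearMap.fst ℂ E ℂ)
    (fun a b y => Prod.ext (hassoc _ _ _) (by
      change χ (m a b) * χ y.1 = χ a * χ (m b y.1)
      rw [hχ, hχ]; ring))
    (fun a y => rfl) ⟨ContinuousLinearMap.inl ℂ E ℂ, fun x => rfl⟩
  have h := congrArg Prod.snd (hψ a a)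
  have h1 : (ψ a).1 = a := hφ a
  rw [ha, map_zero] at h
  change (0 : ℂ) = χ a * χ (ψ a).1 at h
  rw [h1] at h
  exact mul_self_eq_zero.1 h.symm
end

/-! ### From the kernel to a relation on `Z` -/

section
variable {Z : Type u} [TopologicalSpace Z] {B : Type v} [NormedAddCommGroup B] [NormedSpace ℂ B]

/-- Near each `s`, all `φ s'` are within `δ/2` of `φ s`, which is below `δ/2` off a compact set;
finitely many such neighbourhoods cover `K`. -/
theorem exists_isCompact_eval_le {φ : Z → Vanishing Z B} (hφ : Continuous φ) {K : Set Z}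
    (hK : IsCompact K) {δ : ℝ} (hδ : 0 < δ) :
    ∃ S : Set Z, IsCompact S ∧ ∀ s ∈ K, ∀ t, δ < ‖Vanishing.eval t (φ s)‖ → t ∈ S := by
  refine hK.induction_on (p := fun K => ∃ S : Set Z, IsCompact S ∧ ∀ s ∈ K, ∀ t,
    δ < ‖Vanishing.eval t (φ s)‖ → t ∈ S) ⟨∅, isCompact_empty, by simp⟩ ?_ ?_ ?_
  · rintro T T' hT ⟨S, hS, h⟩
    exact ⟨S, hS, fun s hs => h s (hT hs)⟩
  · rintro T T' ⟨S, hS, h⟩ ⟨S', hS', h'⟩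
    exact ⟨S ∪ S', hS.union hS', fun s hs t ht =>
      hs.elim (fun hs => Or.inl (h s hs t ht)) fun hs => Or.inr (h' s hs t ht)⟩
  · intro s _
    obtain ⟨S, hS, h⟩ := mem_cocompact.1
      (Metric.tendsto_nhds.1 (φ s).tendsto_eval (δ / 2) (half_pos hδ))
    refine ⟨{s' | dist (φ s') (φ s) < δ / 2}, mem_nhdsWithin_of_mem_nhds
      (Metric.tendsto_nhds.1 hφ.continuousAt (δ / 2) (half_pos hδ)), S, hS, fun s' hs' t ht => ?_⟩
    by_contra hcon
    have h1 : ‖Vanishing.eval t (φ s)‖ < δ / 2 := by simpa using h hcon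
    have h2 : ‖Vanishing.eval t (φ s' - φ s)‖ < δ / 2 :=
      (Vanishing.norm_eval_le _ _).trans_lt (by rw [← dist_eq_norm]; exact hs')
    rw [map_sub] at h2
    have := norm_add_le (Vanishing.eval t (φ s') - Vanishing.eval t (φ s)) (Vanishing.eval t (φ s))
    rw [sub_add_cancel] at this
    linarith

/-- The product does not vanish identically on a fibre of a projective Banach algebra. -/
theorem BilinearProjective.exists_ne_zero [Nontrivial B]
    {E : Type (max u v)} [NormedAddCommGroup E] [NormedSpace ℂ E] [CompleteSpace E]
    {m : E →L[ℂ] E →L[ℂ] E} (hm : BilinearProjective m)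
    (hassoc : ∀ a b c, m (m a b) c = m a (m b c)) {mB : B →L[ℂ] B →L[ℂ] B} (e : E →L[ℂ] B)
    (he : ∀ a b, e (m a b) = mB (e a) (e b))
    (hzero : (∀ x y, mB x y = 0) → ∀ x, ∃ a, e a = x ∧ m a a = 0) : ∃ x y, mB x y ≠ 0 := by
  by_contra! hcon
  obtain ⟨b, hb⟩ := exists_ne (0 : B)
  obtain ⟨χ, hχ⟩ := SeparatingDual.exists_ne_zero (R := ℂ) hb
  obtain ⟨a, rfl, ha⟩ := hzero hcon b
  exact hχ (hm.eq_zero_of_vanishing hassoc (χ.comp e) (fun a b => by simp [he, hcon]) ha)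

/-- A projective Banach algebra represented in `C₀(Z, B)`, with enough elements of the form
`f • b`, gives a symmetric neighbourhood of the diagonal in which compact sets have relatively
compact images. -/
theorem BilinearProjective.exists_relation [LocallyCompactSpace Z] [CompleteSpace B] [Nontrivial B]
    {E : Type (max u v)} [NormedAddCommGroup E] [NormedSpace ℂ E] [CompleteSpace E]
    {m : E →L[ℂ] E →L[ℂ] E} (hm : BilinearProjective m)
    (hassoc : ∀ a b c, m (m a b) c = m a (m b c)) (mB : B →L[ℂ] B →L[ℂ] B)
    (hassocB : ∀ a b c, mB (mB a b) c = mB a (mB b c)) (r : E →L[ℂ] Vanishing Z B)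
    (hr : ∀ a b t, Vanishing.eval t (r (m a b)) =
      mB (Vanishing.eval t (r a)) (Vanishing.eval t (r b)))
    {F : Type w} (c : F → Z → ℂ) (j : F → B → E)
    (hj : ∀ f b t, Vanishing.eval t (r (j f b)) = c f t • b)
    (hcomm : ∀ f g x y, m (j f x) (j g y) = m (j g x) (j f y))
    (hzero : (∀ x y, mB x y = 0) → ∀ f x, m (j f x) (j f x) = 0)
    (hc : ∀ K : Set Z, IsCompact K → ∃ f, ∀ s ∈ K, c f s = 1) :
    ∃ R : Z → Z → Prop, (∀ s t, R s t → R t s) ∧ (∀ s, ∀ᶠ t in 𝓝 s, R s t) ∧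
      ∀ K : Set Z, IsCompact K → ∃ S : Set Z, IsCompact S ∧ ∀ s ∈ K, ∀ t, R s t → t ∈ S := by
  rcases isEmpty_or_nonempty Z with hZ | ⟨⟨s₀⟩⟩
  · exact ⟨fun _ _ => True, fun _ _ _ => trivial, fun s => hZ.elim s,
      fun K _ => ⟨∅, isCompact_empty, fun s => hZ.elim s⟩⟩
  obtain ⟨x, y, hxy⟩ : ∃ x y, mB x y ≠ 0 := by
    refine hm.exists_ne_zero hassoc ((Vanishing.eval s₀).comp r) (fun a b => hr a b s₀) ?_
    intro h x
    obtain ⟨f, hf⟩ := hc {s₀} isCompact_singleton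
    exact ⟨j f x, by simp [hj, hf], hzero h f x⟩
  obtain ⟨ρ, hρ, hdiag⟩ := hm.exists_kernel hassoc mB hassocB r hr
  choose fs hfs using fun s : Z => hc {s} isCompact_singleton
  -- The extra factor `x` is what makes the value at `s` independent of the cutoff `f`: by `hcomm`,
  -- `f` and `g` can be exchanged in `(f x)(g y)`, and `hρ` takes the first factor out as its value
  -- at `s`.
  let φ : F → Z → Vanishing Z B := fun f s =>
    Vanishing.act mB x (KernelSpace.eval s (ρ (j f y)))
  have hφ : ∀ f, Continuous (φ f) := fun f =>
    (Vanishing.act mB x).continuous.comp (KernelSpace.continuous_eval _)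
  have hindep : ∀ f g s, c f s = 1 → c g s = 1 → φ f s = φ g s := by
    intro f g s hf hg
    refine Vanishing.ext fun t => ?_
    have h1 := hρ (j f x) (j g y) s t
    have h2 := hρ (j g x) (j f y) s t
    rw [hj, hf, one_smul] at h1
    rw [hj, hg, one_smul] at h2
    rw [hcomm, h2] at h1
    exact h1
  set Ψ : Z → Vanishing Z B := fun s => φ (fs s) s with hΨ
  have hΨφ : ∀ f s, c f s = 1 → Ψ s = φ f s := fun f s hf =>
    hindep _ _ s (hfs s s rfl) hf
  have hΨd : ∀ s, Vanishing.eval s (Ψ s) = mB x y := by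
    intro s
    change mB x (Vanishing.eval s (KernelSpace.eval s (ρ (j (fs s) y)))) = _
    rw [hdiag, hj, hfs s s rfl, one_smul]
  have hΨc : Continuous Ψ := by
    refine continuous_iff_continuousAt.2 fun s => ?_
    obtain ⟨K, hK, hKs⟩ := exists_compact_mem_nhds s
    obtain ⟨f, hf⟩ := hc K hK
    -- A single cutoff equal to 1 on a compact neighbourhood of `s` computes `Ψ` there.
    refine (hφ f).continuousAt.congr ?_
    filter_upwards [hKs] with t ht using (hΨφ f t (hf t ht)).symm
  have hδ : 0 < ‖mB x y‖ / 2 := half_pos (norm_pos_iff.2 hxy)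
  refine ⟨fun s t => ‖mB x y‖ / 2 < ‖Vanishing.eval t (Ψ s)‖ ∧
    ‖mB x y‖ / 2 < ‖Vanishing.eval s (Ψ t)‖, fun s t h => h.symm, fun s => ?_, fun K hK => ?_⟩
  · have h1 : ContinuousAt (fun t => ‖Vanishing.eval t (Ψ s)‖) s :=
      (Ψ s).continuous_eval.norm.continuousAt
    have h2 : ContinuousAt (fun t => ‖Vanishing.eval s (Ψ t)‖) s :=
      ((Vanishing.eval s).continuous.comp hΨc).norm.continuousAt
    have hlt : ‖mB x y‖ / 2 < ‖Vanishing.eval s (Ψ s)‖ := by rw [hΨd]; linarith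
    exact (h1.eventually_const_lt hlt).and (h2.eventually_const_lt hlt)
  · obtain ⟨S, hS, h⟩ := exists_isCompact_eval_le hΨc hK hδ
    exact ⟨S, hS, fun s hs t ht => h s hs t ht.1⟩
end

/-! ### Trivializations and sections of the field -/

namespace ContinuousField

variable {Ω : Type u} [TopologicalSpace Ω] {A : Ω → Type v} [∀ t, NonUnitalNormedRing (A t)]
  [∀ t, NormedSpace ℂ (A t)]

/-- A trivialization of the field `𝒰` over the open subset of `Ω` that is the image of `i`. -/
structure Trivialization (𝒰 : ContinuousField A) {P : Type u} [TopologicalSpace P] (i : P → Ω)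
    (B : Type v) [NonUnitalNormedRing B] [NormedSpace ℂ B] where
  θ : ∀ p, A (i p) ≃ₗᵢ[ℂ] B
  map_mul : ∀ p a b, θ p (a * b) = θ p a * θ p b
  isOpenEmbedding : IsOpenEmbedding i
  continuous_apply : ∀ x ∈ 𝒰.Θ, Continuous fun p => θ p (x (i p))
  exists_approx : ∀ y : P → B, Continuous y → ∀ p₀, ∀ ε > 0, ∃ x ∈ 𝒰.Θ,
    ∀ᶠ p in 𝓝 p₀, ‖(θ p).symm (y p) - x (i p)‖ ≤ ε

/-- Membership in the twice restricted field is local approximation by fields that are themselves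
locally approximated by `Θ`; allowing `ε/2` for each stage gives approximation by `Θ` directly. -/
theorem IsTrivial.exists_trivialization (𝒰 : ContinuousField A) {W : Set Ω} (hW : IsOpen W)
    {U : Set W} (hU : IsOpen U) (h : ((𝒰.restrict W).restrict U).IsTrivial) :
    ∃ (B : Type v) (_ : NonUnitalNormedRing B) (_ : NormedSpace ℂ B) (_ : IsScalarTower ℂ B B)
      (_ : SMulCommClass ℂ B B) (_ : CompleteSpace B),
      Nonempty (𝒰.Trivialization (fun p : U => (p : W).1) B) := by
  obtain ⟨B, _, _, _, _, _, ⟨e⟩⟩ := h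
  refine ⟨B, _, _, inferInstance, inferInstance, inferInstance, ⟨⟨e.toFun, e.map_mul,
    hW.isOpenEmbedding_subtypeVal.comp hU.isOpenEmbedding_subtypeVal, fun x hx => ?_,
    fun y hy p₀ ε hε => ?_⟩⟩⟩
  · refine (e.map_Θ (fun p => x p)).1 fun p₀ ε hε => ⟨fun t => x t, fun t₀ ε hε => ?_, ?_⟩
    · exact ⟨x, hx, by simpa using hε.le⟩
    · simpa using hε.le
  · have h1 : (fun p => (e.toFun p).symm (y p)) ∈ ((𝒰.restrict W).restrict U).Θ := by
      refine (e.map_Θ _).2 ?_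
      change Continuous _
      simpa using hy
    obtain ⟨x', hx', h2⟩ := h1 p₀ (ε / 2) (half_pos hε)
    obtain ⟨x, hx, h3⟩ := hx' p₀ (ε / 2) (half_pos hε)
    refine ⟨x, hx, ?_⟩
    filter_upwards [h2, continuous_subtype_val.continuousAt.eventually h3] with p h2 h3
    have := norm_sub_le_norm_sub_add_norm_sub ((e.toFun p).symm (y p)) (x' p) (x p)
    linarith

namespace Trivialization

variable {𝒰 : ContinuousField A} {P : Type u} [TopologicalSpace P] {i : P → Ω}
    {B : Type v} [NonUnitalNormedRing B] [NormedSpace ℂ B] (T : 𝒰.Trivialization i B)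

/-- Compactly supported continuous functions from `P` to `B` are the restrictions of elements of
the section algebra vanishing outside the image of `P`. -/
theorem exists_lift {f : Ω → B} (hf : Continuous f) (hfc : HasCompactSupport f)
    (hfs : tsupport f ⊆ Set.range i) :
    ∃ a : 𝒰.sectionAlgebra, (∀ p, T.θ p (a.1 (i p)) = f (i p)) ∧
      ∀ t, t ∉ Set.range i → a.1 t = 0 := by
  classical
  obtain ⟨x, hx, hx0⟩ : ∃ x : ∀ t, A t, (∀ p, T.θ p (x (i p)) = f (i p)) ∧
      ∀ t, t ∉ Set.range i → x t = 0 := by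
    refine ⟨fun t => if h : ∃ p, i p = t then
      h.choose_spec ▸ (T.θ h.choose).symm (f (i h.choose)) else 0, fun p => ?_,
      fun t ht => dif_neg ht⟩
    have h : ∃ q, i q = i p := ⟨p, rfl⟩
    -- Stated for every preimage `q`, so that injectivity of `i` can eliminate the transport between
    -- fibres before `q` is the chosen one.
    have key : ∀ (q : P) (e : i q = i p),
        T.θ p (e ▸ (T.θ q).symm (f (i q)) : A (i p)) = f (i p) := by
      intro q e
      obtain rfl := T.isOpenEmbedding.injective e
      exact (T.θ q).apply_symm_apply _
    simp only [dif_pos h]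
    exact key _ _
  have hx0' : ∀ t, t ∉ tsupport f → x t = 0 := by
    intro t ht
    by_cases h : t ∈ Set.range i
    · obtain ⟨p, rfl⟩ := h
      exact (T.θ p).map_eq_zero_iff.1 ((hx p).trans (image_eq_zero_of_notMem_tsupport ht))
    · exact hx0 t h
  have hΘ : x ∈ 𝒰.Θ := by
    refine 𝒰.locally_closed x fun t₀ ε hε => ?_
    by_cases h : t₀ ∈ Set.range i
    · obtain ⟨p₀, rfl⟩ := h
      obtain ⟨x', hx', h⟩ := T.exists_approx (fun p => f (i p))
        (hf.comp T.isOpenEmbedding.continuous) p₀ ε hε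
      refine ⟨x', hx', ?_⟩
      rw [← T.isOpenEmbedding.map_nhds_eq]
      refine h.mono fun p hp => ?_
      rwa [← hx p, LinearIsometryEquiv.symm_apply_apply] at hp
    · refine ⟨0, zero_mem _, ?_⟩
      filter_upwards [(isClosed_tsupport f).isOpen_compl.mem_nhds fun ht => h (hfs ht)] with t ht
      simpa [hx0' t ht] using hε.le
  have hlim : Tendsto (fun t => ‖x t‖) (cocompact Ω) (𝓝 0) := by
    refine tendsto_const_nhds.congr' ?_
    filter_upwards [(show IsCompact (tsupport f) from hfc).compl_mem_cocompact] with t ht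
    rw [hx0' t ht, norm_zero]
  exact ⟨⟨⟨x, 𝒰.memℓp_of_vanishing hΘ hlim⟩, hΘ, hlim⟩, hx, hx0⟩

theorem norm_apply_le (a : 𝒰.sectionAlgebra) (t : Ω) : ‖a.1 t‖ ≤ ‖a‖ :=
  lp.norm_apply_le_norm ENNReal.top_ne_zero a.1 t

/-- Restriction of sections to a closed subset of `Ω` over which the field is trivialized. -/
noncomputable def restr {Z : Set P} (hZ : IsClosedEmbedding fun z : Z => i z) :
    𝒰.sectionAlgebra →L[ℂ] Vanishing Z B :=
  LinearMap.mkContinuous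
    ⟨⟨fun a => (show Vanishing Z B from (⟨⟨fun z => T.θ z (a.1 (i z)),
        (T.continuous_apply _ a.2.1).comp continuous_subtype_val⟩, by
          refine tendsto_zero_iff_norm_tendsto_zero.2 ?_
          simp only [LinearIsometryEquiv.norm_map]
          exact a.2.2.comp hZ.tendsto_cocompact⟩ : C₀(Z, B))),
      fun a b => Vanishing.ext fun z => map_add (T.θ z) (a.1 (i z)) (b.1 (i z))⟩,
      fun c a => Vanishing.ext fun z => map_smul (T.θ z) c (a.1 (i z))⟩ 1 fun a =>
        Vanishing.norm_le (by positivity) fun z => by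
          rw [one_mul]
          exact ((T.θ z).norm_map _).le.trans (norm_apply_le a _)

@[simp] theorem eval_restr {Z : Set P} (hZ : IsClosedEmbedding fun z : Z => i z)
    (a : 𝒰.sectionAlgebra) (z : Z) : Vanishing.eval z (T.restr hZ a) = T.θ z (a.1 (i z)) := rfl

/-- The relation furnished by projectivity of the section algebra over a closed subset of `Ω`
on which the field is trivial. -/
theorem exists_relation [T2Space Ω] [LocallyCompactSpace Ω] [∀ t, CompleteSpace (A t)]
    [∀ t, Nontrivial (A t)] [CompleteSpace B] {Z N : Set P}
    (hZ : IsClosedEmbedding fun z : Z => i z) (hN : IsOpen N) (hNZ : N ⊆ Z)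
    {m : 𝒰.sectionAlgebra →L[ℂ] 𝒰.sectionAlgebra →L[ℂ] 𝒰.sectionAlgebra}
    (hm : BilinearProjective m) (hassoc : ∀ a b c, m (m a b) c = m a (m b c))
    {mB : B →L[ℂ] B →L[ℂ] B} (hassocB : ∀ a b c, mB (mB a b) c = mB a (mB b c))
    (hmul : ∀ p a b, T.θ p ((m a b).1 (i p)) = mB (T.θ p (a.1 (i p))) (T.θ p (b.1 (i p))))
    (hm0 : ∀ a b t, a.1 t = 0 → (m a b).1 t = 0) :
    ∃ R : Ω → Ω → Prop, (∀ s t, R s t → R t s) ∧ (∀ p ∈ N, ∀ᶠ t in 𝓝 (i p), R (i p) t) ∧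
      ∀ K : Set Ω, IsCompact K → ∃ S : Set Ω, IsCompact S ∧ ∀ s ∈ K, ∀ t, R s t → t ∈ S := by
  rcases isEmpty_or_nonempty P with hP | ⟨⟨p₀⟩⟩
  · exact ⟨fun _ _ => False, fun _ _ h => h, fun p => hP.elim p,
      fun K _ => ⟨∅, isCompact_empty, fun _ _ _ h => h.elim⟩⟩
  have : Nontrivial B := (T.θ p₀).symm.toEquiv.nontrivial
  have : LocallyCompactSpace Z := hZ.locallyCompactSpace
  -- The cutoffs are supported in the whole trivializing open set, not in `Z`: this leaves room for
  -- them to equal 1 on compact subsets of `Z`. The sections vanish outside that set, so identities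
  -- among them can be checked in `B`.
  have hlift : ∀ (f : {f : C(Ω, ℝ) // HasCompactSupport f ∧ tsupport f ⊆ Set.range i}) (b : B), ∃ a : 𝒰.sectionAlgebra,
      (∀ p, T.θ p (a.1 (i p)) = (f.1 (i p) : ℂ) • b) ∧ ∀ t, t ∉ Set.range i → a.1 t = 0 := by
    intro f b
    have hsub : tsupport (fun t => (f.1 t : ℂ) • b) ⊆ tsupport f.1 :=
      closure_mono fun t ht h => ht (by simp [h])
    exact T.exists_lift (f := fun t => (f.1 t : ℂ) • b) (by fun_prop)
      (f.2.1.of_isClosed_subset (isClosed_tsupport _) hsub) (hsub.trans f.2.2)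
  choose j hj hj0 using hlift
  have hext : ∀ a b : 𝒰.sectionAlgebra, (∀ p, T.θ p (a.1 (i p)) = T.θ p (b.1 (i p))) →
      (∀ t, t ∉ Set.range i → a.1 t = b.1 t) → a = b := by
    intro a b h h0
    refine Subtype.ext (Subtype.ext (funext fun t => ?_))
    by_cases ht : t ∈ Set.range i
    · obtain ⟨p, rfl⟩ := ht
      exact (T.θ p).injective (h p)
    · exact h0 t ht
  obtain ⟨R, hsymm, hnhds, hcpt⟩ := hm.exists_relation hassoc mB hassocB (T.restr hZ)
    (fun a b z => hmul z a b)
    (fun (f : {f : C(Ω, ℝ) // HasCompactSupport f ∧ tsupport f ⊆ Set.range i}) z =>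
      (f.1 (i z) : ℂ)) j (fun f b z => hj f b z)
    (fun f g x y => hext _ _
      (fun p => by rw [hmul, hmul, hj, hj, hj, hj]; simp [smul_smul, mul_comm])
      fun t ht => by rw [hm0 _ _ t (hj0 f x t ht), hm0 _ _ t (hj0 g x t ht)])
    (fun h f x => hext _ _ (fun p => by rw [hmul, h]; exact (map_zero (T.θ p)).symm)
      fun t ht => hm0 _ _ t (hj0 f x t ht))
    (fun K hK => by
      obtain ⟨f, hf1, hf, hfs, -⟩ := exists_continuousMap_one_of_isCompact_subset_isOpen
        (hK.image hZ.continuous) T.isOpenEmbedding.isOpen_range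
        (by rintro _ ⟨z, -, rfl⟩; exact ⟨z, rfl⟩)
      refine ⟨⟨f, hf, hfs⟩, fun z hz => ?_⟩
      have := hf1 (Set.mem_image_of_mem _ hz)
      simpa using this)
  refine ⟨fun s t => ∃ z z' : Z, i z = s ∧ i z' = t ∧ R z z', ?_, fun p hp => ?_,
    fun K hK => ?_⟩
  · rintro s t ⟨z, z', hz, hz', h⟩
    exact ⟨z', z, hz', hz, hsymm _ _ h⟩
  · rw [← T.isOpenEmbedding.map_nhds_eq, eventually_map]
    -- The relation lives on `Z`, and only at points of the open set `N` are neighbourhoods in `Z`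
    -- also neighbourhoods in `Ω`.
    have hZp : Z ∈ 𝓝 p := mem_of_superset (hN.mem_nhds hp) hNZ
    rw [← map_nhds_subtype_coe_eq_nhds (hNZ hp) hZp, eventually_map]
    exact (hnhds ⟨p, hNZ hp⟩).mono fun z hz => ⟨⟨p, hNZ hp⟩, z, rfl, rfl, hz⟩
  · obtain ⟨S, hS, h⟩ := hcpt _ (hZ.isCompact_preimage hK)
    refine ⟨(fun z : Z => i z) '' S, hS.image hZ.continuous, ?_⟩
    rintro s hs t ⟨z, z', rfl, rfl, hzz⟩
    exact ⟨z', h z hs z' hzz, rfl⟩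

end Trivialization

section
variable [T2Space Ω] [LocallyCompactSpace Ω] [∀ t, IsScalarTower ℂ (A t) (A t)]
  [∀ t, SMulCommClass ℂ (A t) (A t)] [∀ t, CompleteSpace (A t)] [∀ t, Nontrivial (A t)]
  {𝒰 : ContinuousField A}

theorem Trivialization.exists_relation_of_isProjective {P : Type u} [TopologicalSpace P]
    {i : P → Ω} {B : Type v} [NonUnitalNormedRing B] [NormedSpace ℂ B] [IsScalarTower ℂ B B]
    [SMulCommClass ℂ B B] [CompleteSpace B] (T : 𝒰.Trivialization i B) {Z N : Set P}
    (hZ : IsClosedEmbedding fun z : Z => i z) (hN : IsOpen N) (hNZ : N ⊆ Z)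
    (hproj : IsLeftProjective 𝒰.sectionAlgebra ∨ IsRightProjective 𝒰.sectionAlgebra) :
    ∃ R : Ω → Ω → Prop, (∀ s t, R s t → R t s) ∧ (∀ p ∈ N, ∀ᶠ t in 𝓝 (i p), R (i p) t) ∧
      ∀ K : Set Ω, IsCompact K → ∃ S : Set Ω, IsCompact S ∧ ∀ s ∈ K, ∀ t, R s t → t ∈ S := by
  rcases hproj with h | h
  · exact T.exists_relation hZ hN hNZ h.bilinearProjective (fun a b c => mul_assoc a b c)
      (mB := ContinuousLinearMap.mul ℂ B) (fun a b c => mul_assoc a b c)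
      (fun p a b => T.map_mul p _ _)
      fun a b t ht => (congrArg (· * b.1 t) ht).trans (zero_mul (b.1 t))
  · exact T.exists_relation hZ hN hNZ h.bilinearProjective (fun a b c => (mul_assoc c b a).symm)
      (mB := (ContinuousLinearMap.mul ℂ B).flip) (fun a b c => (mul_assoc c b a).symm)
      (fun p a b => T.map_mul p _ _)
      fun a b t ht => (congrArg (b.1 t * ·) ht).trans (mul_zero (b.1 t))

/-- The closed piece is the closure of `V` in `W`. It is closed in `Ω` because `W` is, so sections
restricted to it still vanish at infinity. -/
theorem exists_relation_of_isProjective {W : Set Ω} (hW : IsClopen W) {U V : Set W}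
    (hU : IsOpen U) (hUtriv : ((𝒰.restrict W).restrict U).IsTrivial) (hV : IsOpen V)
    (hVU : closure V ⊆ U)
    (hproj : IsLeftProjective 𝒰.sectionAlgebra ∨ IsRightProjective 𝒰.sectionAlgebra) :
    ∃ R : Ω → Ω → Prop, (∀ s t, R s t → R t s) ∧ (∀ p ∈ V, ∀ᶠ t in 𝓝 p.1, R p.1 t) ∧
      ∀ K : Set Ω, IsCompact K → ∃ S : Set Ω, IsCompact S ∧ ∀ s ∈ K, ∀ t, R s t → t ∈ S := by
  obtain ⟨B, _, _, _, _, _, ⟨T⟩⟩ := hUtriv.exists_trivialization 𝒰 hW.isOpen hU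
  have hZ : IsClosedEmbedding
      fun z : ((↑) ⁻¹' closure V : Set U) => ((z : U) : W).1 := by
    refine ⟨(IsEmbedding.subtypeVal.comp IsEmbedding.subtypeVal).comp IsEmbedding.subtypeVal, ?_⟩
    have : Set.range (fun z : ((↑) ⁻¹' closure V : Set U) => ((z : U) : W).1) =
        Subtype.val '' closure V := by
      ext t
      constructor
      · rintro ⟨z, rfl⟩
        exact ⟨z.1.1, z.2, rfl⟩
      · rintro ⟨w, hw, rfl⟩
        exact ⟨⟨⟨w, hVU hw⟩, hw⟩, rfl⟩
    rw [this]
    exact hW.isClosed.isClosedEmbedding_subtypeVal.isClosedMap _ isClosed_closure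
  obtain ⟨R, hsymm, hnhds, hcpt⟩ := T.exists_relation_of_isProjective hZ
    (hV.preimage continuous_subtype_val) (Set.preimage_mono subset_closure) hproj
  exact ⟨R, hsymm, fun p hp => hnhds ⟨p, hVU (subset_closure hp)⟩ hp, hcpt⟩
end

end ContinuousField

/-! ### Gluing the relations over all pieces -/

theorem theorem4p6 {Ω : Type u} [TopologicalSpace Ω] [T2Space Ω] [LocallyCompactSpace Ω]
    {A : Ω → Type v} [∀ t, NonUnitalNormedRing (A t)] [∀ t, NormedSpace ℂ (A t)]
    [∀ t, IsScalarTower ℂ (A t) (A t)] [∀ t, SMulCommClass ℂ (A t) (A t)]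
    [∀ t, CompleteSpace (A t)] [∀ t, Nontrivial (A t)]
    (𝒰 : ContinuousField A)
    {M : Type w} (W : M → Set Ω) (hW_open : ∀ μ, IsOpen (W μ))
    (hW_disjoint : Pairwise fun μ ν => Disjoint (W μ) (W ν)) (hW_cover : ⋃ μ, W μ = Set.univ)
    (hW_triv : ∀ μ, (𝒰.restrict (W μ)).IsSigmaLocallyTrivial)
    (hproj : IsLeftProjective 𝒰.sectionAlgebra ∨ IsRightProjective 𝒰.sectionAlgebra) :
    ParacompactSpace Ω := by
  have hmemW : ∀ t, ∃ μ, t ∈ W μ := fun t => Set.mem_iUnion.1 (hW_cover ▸ Set.mem_univ t)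
  have huniq : ∀ {t μ ν}, t ∈ W μ → t ∈ W ν → μ = ν := fun {t μ ν} h h' => by
    by_contra hne
    exact Set.disjoint_left.1 (hW_disjoint hne) h h'
  have hclopen : ∀ μ, IsClopen (W μ) := by
    refine fun μ => ⟨isOpen_compl_iff.1 (isOpen_iff_mem_nhds.2 fun t ht => ?_), hW_open μ⟩
    obtain ⟨ν, hν⟩ := hmemW t
    filter_upwards [(hW_open ν).mem_nhds hν] with s hs hs'
    exact ht (huniq hs' hs ▸ hν)
  choose 𝓒 h𝓒 _ 𝓥 h𝓥c h𝓥 h𝓥cov using hW_triv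
  have hR : ∀ (μ : M) (V : 𝓥 μ), ∃ R : Ω → Ω → Prop, (∀ s t, R s t → R t s) ∧
      (∀ p ∈ V.1, ∀ᶠ t in 𝓝 p.1, R p.1 t) ∧
      ∀ K : Set Ω, IsCompact K → ∃ S : Set Ω, IsCompact S ∧ ∀ s ∈ K, ∀ t, R s t → t ∈ S := by
    intro μ V
    obtain ⟨hV, U, hU, hVU⟩ := h𝓥 μ V.1 V.2
    exact ContinuousField.exists_relation_of_isProjective (hclopen μ) (h𝓒 μ U hU).1
      (h𝓒 μ U hU).2 hV hVU hproj
  choose R hsymm hnhds hcpt using hR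
  -- Requiring both points to lie in `W μ` ensures that only the finitely many `μ` met by a compact
  -- set contribute to its image, although `M` may be uncountable.
  refine paracompactSpace_of_relation (fun s t => ∃ μ, s ∈ W μ ∧ t ∈ W μ ∧ ∃ V, R μ V s t)
    ?_ (fun s => ?_) fun K hK => ?_
  · rintro s t ⟨μ, hs, ht, V, h⟩
    exact ⟨μ, ht, hs, V, hsymm _ _ _ _ h⟩
  · obtain ⟨μ, hs⟩ := hmemW s
    obtain ⟨V, hV, hsV⟩ : (⟨s, hs⟩ : W μ) ∈ ⋃₀ 𝓥 μ := h𝓥cov μ ▸ Set.mem_univ _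
    filter_upwards [hnhds μ ⟨V, hV⟩ _ hsV, (hW_open μ).mem_nhds hs] with t h ht
    exact ⟨μ, hs, ht, ⟨V, hV⟩, h⟩
  · obtain ⟨F, hF⟩ := hK.elim_finite_subcover W hW_open (hW_cover ▸ Set.subset_univ K)
    choose S hS h using fun μ V => hcpt μ V K hK
    have : ∀ μ, Countable (𝓥 μ) := fun μ => (h𝓥c μ).to_subtype
    refine ⟨⋃ μ : F, ⋃ V, S μ V, isSigmaCompact_iUnion _ fun μ =>
      isSigmaCompact_iUnion _ fun V => (hS _ _).isSigmaCompact, ?_⟩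
    rintro s hs t ⟨μ, hsμ, -, V, hst⟩
    obtain ⟨ν, hν, hsν⟩ := Set.mem_iUnion₂.1 (hF hs)
    obtain rfl := huniq hsμ hsν
    exact Set.mem_iUnion.2 ⟨⟨μ, hν⟩, Set.mem_iUnion.2 ⟨V, h μ V s hs t hst⟩⟩
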